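/- Let $X$ be a connected non-compact $C^\infty$ manifold (finite-dimensional, Hausdorff, second countable; for instance a connected non-compact Riemannian manifold), let $\mathcal D=C^\infty_{\rm fin}(X)$ be the space of real-valued smooth functions on $X$ with compact support, and let $\sigma$ be a Borel measure on $X$ which is finite on compact sets, positive on non-empty open sets, satisfies $\sigma(\{x\})=0$ for all $x\in X$, and $\sigma(X)=+\infty$. Let $\Gamma(X)$ be the set of all $\gamma\subset X$ with $|\gamma\cap\Lambda|<\infty$ for every compact $\Lambda\subset X$, and put $\langle\gamma,f\rangle=\sum_{x\in\gamma}f(x)$ for $f\in\mathcal D$. For $Y\subset X$ let $\Gamma_0(Y)$ be the set of all finite subsets of $Y$. The set $\Gamma_0(X)=\bigsqcup_{n\ge0}\Gamma^{(n)}$, $\Gamma^{(n)}=\{\xi\subset X:|\xi|=n\}$, carries the topology of the disjoint sum of the spaces $\Gamma^{(n)}$, each with the quotient topology from $\{(x_1,\dots,x_n)\in X^n: x_j\ne x_k,\ j\neq k\}$, and $\Gamma_0(Y)$ carries the relative topology. The set $\Gamma(X)=\Gamma_0(X)\sqcup(\Gamma(X)\setminus\Gamma_0(X))$ carries the topology of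 the disjoint sum of $\Gamma_0(X)$ with the topology just described and of $\Gamma(X)\setminus\Gamma_0(X)$ with the vague topology, i.e. the coarsest one for which all $\gamma\mapsto\langle\gamma,f\rangle$, $f\in\mathcal D$, are continuous. Let $\mathcal B(\cdot)$ denote Borel $\sigma$-algebras. The Lebesgue–Poisson measure $\lambda$ on $\mathcal B(\Gamma_0(X))$ is $$\lambda(\alpha)=\sum_{n=0}^\infty\frac1{n!}\,\sigma^{\otimes n}\big(\{(x_1,\dots,x_n)\in X^n:\ x_j\neq x_k\ (j\ne k),\ \{x_1,\dots,x_n\}\in\alpha\}\big),$$ where the term $n=0$ is $1$ if $\varnothing\in\alpha$ and $0$ otherwise. Then there is a unique probability measure $\pi$ on $\mathcal B(\Gamma(X))$ (the Poisson measure) such that $$\pi(\{\gamma\in\Gamma(X):\gamma\cap Y\in\alpha\})=e^{-\sigma(Y)}\lambda(\alpha)$$ for all Borel sets $Y\subset X$ with compact closure and all $\alpha\in\mathcal B(\Gamma_0(Y))$. For every $f\in\mathcal D$ the function $\gamma\mapsto e^{\langle\gamma,f\rangle}$ is $\pi$-integrable, $e^f-1$ is $\sigma$-integrable, and $$\int_{\Gamma(X)}e^{\langle\gamma,f\rangle}\,d\pi(\gamma)=\exp\Big(\int_X\big(e^{f(x)}-1\big)\,d\sigma(x)\Big).$$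 -/

import Mathlib

open MeasureTheory Set
open scoped ENNReal Nat Manifold ContDiff

/-- The space `Γ(X)` of configurations: locally finite subsets of `X`. -/
structure Configuration (X : Type*) [TopologicalSpace X] where
  carrier : Set X
  finite_inter : ∀ Λ : Set X, IsCompact Λ → (carrier ∩ Λ).Finite

/-- The space `Γ₀(X)` of finite configurations: finite subsets of `X`, the empty one included. -/
structure FiniteConfiguration (X : Type*) where
  carrier : Set X
  finite : carrier.Finite

/-- The space `𝒟 = C_fin^∞(X)` of real-valued smooth functions with compact support on the
`d`-dimensional manifold `X`. -/
def SmoothTestFunction (d : ℕ) (X : Type*) [TopologicalSpace X]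
    [ChartedSpace (EuclideanSpace ℝ (Fin d)) X] : Type _ :=
  {f : X → ℝ // ContMDiff (𝓡 d) 𝓘(ℝ, ℝ) ∞ f ∧ HasCompactSupport f}

instance (d : ℕ) (X : Type*) [TopologicalSpace X]
    [ChartedSpace (EuclideanSpace ℝ (Fin d)) X] : CoeFun (SmoothTestFunction d X) (fun _ => X → ℝ) where
  coe f := f.1

namespace Configuration

variable {X : Type*} [TopologicalSpace X]

/-- `⟨γ, f⟩ = ∑_{x ∈ γ} f x`. For `f` of compact support only finitely many terms are nonzero. -/
noncomputable def pairing (γ : Configuration X) (f : X → ℝ) : ℝ :=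
  ∑ᶠ x ∈ γ.carrier, f x

/-- The projection `p_Y : Γ(X) → Γ₀(Y) ⊆ Γ₀(X)`, `γ ↦ γ ∩ Y`, for `Y` with compact closure. -/
def proj (Y : Set X) (hY : IsCompact (closure Y)) (γ : Configuration X) :
    FiniteConfiguration X :=
  ⟨γ.carrier ∩ Y, (γ.finite_inter _ hY).subset (inter_subset_inter_right _ subset_closure)⟩

end Configuration

namespace FiniteConfiguration

variable {X : Type*}

/-- The inclusion `Γ₀(X) ⊆ Γ(X)`. -/
def toConfiguration [TopologicalSpace X] (ξ : FiniteConfiguration X) : Configuration X :=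
  ⟨ξ.carrier, fun _ _ => ξ.finite.subset inter_subset_left⟩

/-- The subset `Γ₀(Y)` of `Γ₀(X)`, for `Y ⊆ X`. -/
def within (Y : Set X) : Set (FiniteConfiguration X) :=
  {ξ | ξ.carrier ⊆ Y}

/-- The configuration `[x₁, …, xₙ]` of a tuple of pairwise distinct points. -/
def ofTuple (n : ℕ) (x : {x : Fin n → X // Function.Injective x}) : FiniteConfiguration X :=
  ⟨range x.1, finite_range x.1⟩

/-- The ordinary topology of `Γ₀(X) = ⨆ₙ Γ⁽ⁿ⁾`: the disjoint sum of the spaces `Γ⁽ⁿ⁾`, where `Γ⁽ⁿ⁾`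
is the space of `n`-tuples of distinct points of `X` (with the topology of `Xⁿ`) up to order. -/
instance ordinaryTopology [TopologicalSpace X] : TopologicalSpace (FiniteConfiguration X) :=
  TopologicalSpace.coinduced
    (fun p : (Σ n : ℕ, {x : Fin n → X // Function.Injective x}) => ofTuple p.1 p.2) inferInstance

instance [TopologicalSpace X] : MeasurableSpace (FiniteConfiguration X) := borel _

instance [TopologicalSpace X] : BorelSpace (FiniteConfiguration X) := ⟨rfl⟩

end FiniteConfiguration

/-- The vague topology on `Γ(X)`: the one induced from the weak topology of `𝒟'` by
`γ ↦ ⟨γ, ·⟩`, that is, from pointwise convergence on `𝒟`. -/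
@[reducible]
noncomputable def vagueTopology (d : ℕ) (X : Type*) [TopologicalSpace X]
    [ChartedSpace (EuclideanSpace ℝ (Fin d)) X] : TopologicalSpace (Configuration X) :=
  TopologicalSpace.induced
    (fun (γ : Configuration X) (f : SmoothTestFunction d X) => γ.pairing f)
    (inferInstance : TopologicalSpace (SmoothTestFunction d X → ℝ))

/-- The ordinary-vague topology on `Γ(X) = Γ₀(X) ⊔ (Γ(X) ∖ Γ₀(X))`: the disjoint sum of `Γ₀(X)` with
the ordinary topology and of the infinite configurations with the relative vague topology.
(A set is open for it when its preimages in both parts are open.) -/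
@[reducible]
noncomputable def ordinaryVagueTopology (d : ℕ) (X : Type*) [TopologicalSpace X]
    [ChartedSpace (EuclideanSpace ℝ (Fin d)) X] : TopologicalSpace (Configuration X) :=
  TopologicalSpace.coinduced (FiniteConfiguration.toConfiguration (X := X)) inferInstance ⊔
  TopologicalSpace.coinduced (Subtype.val : {γ : Configuration X // γ.carrier.Infinite} → _)
    (TopologicalSpace.induced Subtype.val (vagueTopology d X))

/-- The Borel `σ`-algebra `ℬ(Γ(X))` of the ordinary-vague topology. -/
@[reducible]
noncomputable def configurationBorel (d : ℕ) (X : Type*) [TopologicalSpace X]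
    [ChartedSpace (EuclideanSpace ℝ (Fin d)) X] : MeasurableSpace (Configuration X) :=
  @borel _ (ordinaryVagueTopology d X)

/-- The Lebesgue–Poisson measure `λ = ∑ₙ (1/n!) σ⁽ⁿ⁾` on `Γ₀(X)`, where `σ⁽ⁿ⁾` is the product
measure on `Xⁿ`, restricted to tuples of distinct points and carried over to `Γ⁽ⁿ⁾`.
See `lebesguePoisson_apply` for the value on a Borel set. -/
noncomputable def lebesguePoisson {X : Type*} [TopologicalSpace X] [MeasurableSpace X]
    (σ : Measure X) : Measure (FiniteConfiguration X) :=
  Measure.sum fun n : ℕ => (n ! : ℝ≥0∞)⁻¹ •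
    ((Measure.pi fun _ : Fin n => σ).comap
      (Subtype.val : {x : Fin n → X // Function.Injective x} → _)).map
        (FiniteConfiguration.ofTuple n)

theorem measurableSet_injective {X : Type*} [TopologicalSpace X] [T2Space X]
    [SecondCountableTopology X] [MeasurableSpace X] [BorelSpace X] (n : ℕ) :
    MeasurableSet {x : Fin n → X | Function.Injective x} := by
  have : {x : Fin n → X | Function.Injective x} =
      ⋂ i : Fin n, ⋂ j : Fin n, {x | x i = x j → i = j} := by
    ext x
    simp [Function.Injective]
  rw [this]
  refine MeasurableSet.iInter fun i => MeasurableSet.iInter fun j => ?_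
  by_cases h : i = j
  · simp [h]
  · simp only [h, imp_false]
    exact (isOpen_ne_fun (continuous_apply i) (continuous_apply j)).measurableSet

theorem measurable_ofTuple {X : Type*} [TopologicalSpace X]
    [SecondCountableTopology X] [MeasurableSpace X] [BorelSpace X] (n : ℕ) :
    Measurable (FiniteConfiguration.ofTuple (X := X) n) := by
  have h : Continuous (fun p : (Σ n : ℕ, {x : Fin n → X // Function.Injective x}) =>
      FiniteConfiguration.ofTuple p.1 p.2) := continuous_coinduced_rng
  exact (h.comp (continuous_sigmaMk (σ := fun n : ℕ => {x : Fin n → X // Function.Injective x})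
    (i := n))).measurable

theorem lebesguePoisson_apply {X : Type*} [TopologicalSpace X] [T2Space X]
    [SecondCountableTopology X] [MeasurableSpace X] [BorelSpace X] (σ : Measure X)
    {α : Set (FiniteConfiguration X)} (hα : MeasurableSet α) :
    lebesguePoisson σ α = ∑' n : ℕ, (n ! : ℝ≥0∞)⁻¹ *
      Measure.pi (fun _ : Fin n => σ)
        {x | ∃ hx : Function.Injective x, FiniteConfiguration.ofTuple n ⟨x, hx⟩ ∈ α} := by
  rw [lebesguePoisson, Measure.sum_apply _ hα]
  refine tsum_congr fun n => ?_
  have hm : MeasurableSet (FiniteConfiguration.ofTuple n ⁻¹' α) := measurable_ofTuple n hα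
  rw [Measure.smul_apply, Measure.map_apply (measurable_ofTuple n) hα,
    (MeasurableEmbedding.subtype_coe (measurableSet_injective n)).comap_apply, smul_eq_mul]
  congr 2
  ext x
  simp

/-- `π` is a Poisson measure with intensity `σ`: a probability measure on `ℬ(Γ(X))` which, for all
Borel sets `Y` of compact closure, projects onto the measure `π^Y = e^{-σ(Y)} λ` on `Γ₀(Y)`.
The Borel sets of the subspace `Γ₀(Y)` of `Γ₀(X)` are the `β ∩ Γ₀(Y)` with `β ∈ ℬ(Γ₀(X))`. -/
structure IsPoissonMeasure (d : ℕ) {X : Type*} [TopologicalSpace X]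
    [ChartedSpace (EuclideanSpace ℝ (Fin d)) X] [MeasurableSpace X] (σ : Measure X)
    (π : @Measure (Configuration X) (configurationBorel d X)) : Prop where
  isProbabilityMeasure : IsProbabilityMeasure π
  proj_eq : ∀ (Y : Set X) (hY : IsCompact (closure Y)), MeasurableSet Y →
    ∀ β : Set (FiniteConfiguration X), MeasurableSet β →
      π (Configuration.proj Y hY ⁻¹' (β ∩ FiniteConfiguration.within Y)) =
        ENNReal.ofReal (Real.exp (-(σ Y).toReal)) *
          lebesguePoisson σ (β ∩ FiniteConfiguration.within Y)

/-! Everything reduces to void events, "no point in `B`" for `B` Borel of compact closure. They form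
a π-system because avoiding `B` and `C` is avoiding `B ∪ C`, and they generate the Borel σ-algebra
of the ordinary-vague topology (`configurationBorel_eq_generateFrom`). This holds because counts of
points in open sets are read off from void events through a countable basis
(`measurableSet_of_forall_exists_isOpen`), while conversely a void event of an open set is the zero
set of the pairing with a smooth bump function.

The measure `λ` integrates multiplicative functionals to exponential series
(`lintegral_lebesguePoisson`), so `e^{-σ(Y)} λ` on `Γ₀(Y)` has void probabilities `e^{-σ(Y ∩ B)}`.
Being Poisson is therefore equivalent to `π (void B) = e^{-σ(B)}`, which gives uniqueness by the π-λ
theorem. For existence, independent finite-volume Poisson configurations in the cells of a locally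
finite partition are superposed (`exists_measure_void`). The Laplace transform is again the integral
of a multiplicative functional, taken on the compact support of `f`. -/

/-! ### Integration against the Lebesgue–Poisson measure -/

theorem pi_diagonal_eq_zero {X : Type*} [TopologicalSpace X] [T2Space X]
    [SecondCountableTopology X] [MeasurableSpace X] [BorelSpace X] (σ : Measure X)
    [SigmaFinite σ] [NullSingletonClass σ] {n : ℕ} {i j : Fin n} (hij : i ≠ j) :
    Measure.pi (fun _ : Fin n => σ) {x | x i = x j} = 0 := by
  cases n with
  | zero => exact i.elim0
  | succ m =>
    obtain ⟨k, rfl⟩ := Fin.exists_succAbove_eq hij.symm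
    have hs : MeasurableSet {p : X × (Fin m → X) | p.1 = p.2 k} :=
      measurableSet_eq_fun measurable_fst ((measurable_pi_apply k).comp measurable_snd)
    have h := (measurePreserving_piFinSuccAbove (fun _ : Fin (m + 1) => σ) i).measure_preimage
      hs.nullMeasurableSet
    have h2 : (σ.prod (Measure.pi fun _ : Fin m => σ)) {p | p.1 = p.2 k} = 0 := by
      -- With the other coordinates fixed, the slice in the `i`-th coordinate is a single point,
      -- hence null.
      rw [Measure.prod_apply_symm hs]
      simp [Set.preimage]
    exact h.trans h2

theorem ae_injective_pi {X : Type*} [TopologicalSpace X] [T2Space X]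
    [SecondCountableTopology X] [MeasurableSpace X] [BorelSpace X] (σ : Measure X)
    [SigmaFinite σ] [NullSingletonClass σ] (n : ℕ) :
    ∀ᵐ x ∂(Measure.pi fun _ : Fin n => σ), Function.Injective x := by
  have h : ∀ᵐ x ∂(Measure.pi fun _ : Fin n => σ), ∀ i j : Fin n, i ≠ j → x i ≠ x j := by
    refine ae_all_iff.2 fun i => ae_all_iff.2 fun j => ?_
    by_cases hij : i = j
    · simp [hij]
    · simpa [ae_iff, hij] using pi_diagonal_eq_zero σ hij
  filter_upwards [h] with x hx i j hxij
  by_contra hij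
  exact hx i j hij hxij

theorem lintegral_pi_prod_eq_pow {X : Type*} [MeasurableSpace X] (σ : Measure X) [SigmaFinite σ]
    {g : X → ℝ≥0∞} (hg : Measurable g) (n : ℕ) :
    ∫⁻ x, ∏ i, g (x i) ∂(Measure.pi fun _ : Fin n => σ) = (∫⁻ x, g x ∂σ) ^ n := by
  induction n with
  | zero => simp
  | succ m ih =>
    have hG : Measurable fun y : Fin m → X => ∏ i, g (y i) :=
      Finset.measurable_prod _ fun i _ => hg.comp (measurable_pi_apply i)
    have h := (measurePreserving_piFinSuccAbove (fun _ : Fin (m + 1) => σ) 0).lintegral_comp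
      (f := fun p : X × (Fin m → X) => g p.1 * ∏ i, g (p.2 i))
      ((hg.comp measurable_fst).mul (hG.comp measurable_snd))
    rw [lintegral_prod_mul hg.aemeasurable hG.aemeasurable, ih] at h
    rw [pow_succ', ← h]
    refine lintegral_congr fun x => ?_
    rw [Fin.prod_univ_succ]
    rfl

/-- Integration of a multiplicative functional against the Lebesgue–Poisson measure. -/
theorem lintegral_lebesguePoisson {X : Type*} [TopologicalSpace X] [T2Space X]
    [SecondCountableTopology X] [MeasurableSpace X] [BorelSpace X] (σ : Measure X)
    [SigmaFinite σ] [NullSingletonClass σ] {G : FiniteConfiguration X → ℝ≥0∞} (hG : Measurable G)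
    {g : X → ℝ≥0∞} (hg : Measurable g)
    (hGg : ∀ (n : ℕ) (x : {x : Fin n → X // Function.Injective x}),
      G (FiniteConfiguration.ofTuple n x) = ∏ i, g (x.1 i)) :
    ∫⁻ ξ, G ξ ∂(lebesguePoisson σ) = ∑' n : ℕ, (n ! : ℝ≥0∞)⁻¹ * (∫⁻ x, g x ∂σ) ^ n := by
  rw [lebesguePoisson, lintegral_sum_measure]
  refine tsum_congr fun n => ?_
  rw [lintegral_smul_measure, smul_eq_mul, lintegral_map hG (measurable_ofTuple n)]
  congr 1
  simp_rw [hGg]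
  refine (lintegral_subtype_comap (measurableSet_injective n)
    (fun x : Fin n → X => ∏ i, g (x i))).trans ?_
  rw [Measure.restrict_eq_self_of_ae_mem (s := {x | Function.Injective x}) (ae_injective_pi σ n),
    lintegral_pi_prod_eq_pow σ hg n]

theorem tsum_inv_factorial_mul_pow (a : ℝ≥0∞) (ha : a ≠ ⊤) :
    ∑' n : ℕ, (n ! : ℝ≥0∞)⁻¹ * a ^ n = ENNReal.ofReal (Real.exp a.toReal) := by
  have h : ∀ n : ℕ, (n ! : ℝ≥0∞)⁻¹ * a ^ n = ENNReal.ofReal (a.toReal ^ n / n !) := by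
    intro n
    rw [div_eq_inv_mul, ENNReal.ofReal_mul (by positivity), ENNReal.ofReal_pow (by positivity),
      ENNReal.ofReal_toReal ha, ENNReal.ofReal_inv_of_pos (by positivity), ENNReal.ofReal_natCast]
  simp_rw [h]
  rw [← ENNReal.ofReal_tsum_of_nonneg (fun n => by positivity)
    (Real.summable_pow_div_factorial _), Real.exp_eq_exp_ℝ, NormedSpace.exp_eq_tsum_div]

/-! ### Measurability for random finite sets -/

/-- Distinct points have disjoint basic neighbourhoods inside prescribed ones. -/
theorem exists_countableBasis_pairwise_disjoint {X : Type*} [TopologicalSpace X] [T2Space X]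
    [SecondCountableTopology X] {n : ℕ} {x : Fin n → X} (hx : Function.Injective x)
    {O : Fin n → Set X} (hO : ∀ i, IsOpen (O i) ∧ x i ∈ O i) :
    ∃ s : Fin n → TopologicalSpace.countableBasis X,
      Pairwise (fun i j => Disjoint (s i : Set X) (s j)) ∧
        ∀ i, x i ∈ (s i : Set X) ∧ (s i : Set X) ⊆ O i := by
  obtain ⟨U, hU, hdisj⟩ := (finite_range x).t2_separation
  have h : ∀ i, ∃ s ∈ TopologicalSpace.countableBasis X, x i ∈ s ∧ s ⊆ O i ∩ U (x i) := fun i =>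
    (TopologicalSpace.isBasis_countableBasis X).exists_subset_of_mem_open
      ⟨(hO i).2, (hU (x i)).1⟩ ((hO i).1.inter (hU (x i)).2)
  choose s hs hxs hsO using h
  refine ⟨fun i => ⟨s i, hs i⟩, fun i j hij => ?_, fun i =>
    ⟨hxs i, (hsO i).trans inter_subset_left⟩⟩
  exact (hdisj (mem_range_self i) (mem_range_self j) (hx.ne hij)).mono
    ((hsO i).trans inter_subset_right) ((hsO j).trans inter_subset_right)

theorem measurableSet_inter_nonempty {X : Type*} [TopologicalSpace X]
    {Ω : Type*} [MeasurableSpace Ω] {c : Ω → Set X}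
    (h : ∀ U, IsOpen U → MeasurableSet {w | c w ∩ U = ∅})
    {U : Set X} (hU : IsOpen U) : MeasurableSet {w | (c w ∩ U).Nonempty} := by
  simp_rw [nonempty_iff_ne_empty]
  exact (h U hU).compl

section RandomSets

variable {X : Type*} [TopologicalSpace X] [T2Space X] [SecondCountableTopology X]
  {Ω : Type*} [MeasurableSpace Ω] {c : Ω → Set X}

/-- There are at least `n` points in `U` exactly when `n` pairwise disjoint basic open sets each
contain a point of the set lying in `U`. A countable basis leaves only countably many choices. -/
theorem measurable_ncard_inter_isOpen (hc : ∀ w, (c w).Finite)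
    (h : ∀ U, IsOpen U → MeasurableSet {w | c w ∩ U = ∅}) {U : Set X} (hU : IsOpen U) :
    Measurable fun w => (c w ∩ U).ncard := by
  refine measurable_of_Ici fun n => ?_
  have key : (fun w => (c w ∩ U).ncard) ⁻¹' Ici n =
      ⋃ s ∈ {s : Fin n → TopologicalSpace.countableBasis X |
        Pairwise (fun i j => Disjoint (s i : Set X) (s j))},
        ⋂ i, {w | (c w ∩ (U ∩ s i)).Nonempty} := by
    ext w
    simp only [mem_preimage, mem_Ici, mem_iUnion, mem_iInter, mem_ofPred_eq, exists_prop]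
    have hfin : (c w ∩ U).Finite := (hc w).subset inter_subset_left
    constructor
    · intro hn
      obtain ⟨t, htU, htn⟩ := exists_subset_card_eq hn
      have htf : t.Finite := hfin.subset htU
      obtain ⟨m, x, hxi, hxr⟩ := htf.fin_param
      obtain rfl : m = n := by
        rw [← htn, ← hxr, ← image_univ, ncard_image_of_injective _ hxi, ncard_univ,
          Nat.card_eq_fintype_card, Fintype.card_fin]
      have hxU : ∀ i, x i ∈ c w ∩ U := fun i => htU (hxr ▸ mem_range_self i)
      obtain ⟨s, hs, hxs⟩ := exists_countableBasis_pairwise_disjoint hxi (O := fun _ => U)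
        fun i => ⟨hU, (hxU i).2⟩
      exact ⟨s, hs, fun i => ⟨x i, (hxU i).1, (hxU i).2, (hxs i).1⟩⟩
    · rintro ⟨s, hs, hne⟩
      choose x hxc hxU hxs using hne
      have hxi : Function.Injective x := by
        intro i j hij
        by_contra hne
        exact disjoint_left.1 (hs hne) (hxs i) (hij ▸ hxs j)
      have : (range x).ncard = n := by
        rw [← image_univ, ncard_image_of_injective _ hxi, ncard_univ,
          Nat.card_eq_fintype_card, Fintype.card_fin]
      rw [← this]
      exact ncard_le_ncard (range_subset_iff.2 fun i => ⟨hxc i, hxU i⟩) hfin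
  rw [key]
  refine MeasurableSet.biUnion (to_countable _) fun s _ => MeasurableSet.iInter fun i => ?_
  exact measurableSet_inter_nonempty h (hU.inter
    (TopologicalSpace.isOpen_of_mem_countableBasis (s i).2))

/-- If a random finite set has measurable void events for open sets, then its void events are
measurable for all Borel sets. -/
theorem measurableSet_inter_eq_empty [MeasurableSpace X] [BorelSpace X]
    (hc : ∀ w, (c w).Finite)
    (h : ∀ U, IsOpen U → MeasurableSet {w | c w ∩ U = ∅}) {B : Set X} (hB : MeasurableSet B) :
    MeasurableSet {w | c w ∩ B = ∅} := by
  have hfin : ∀ w, IsFiniteMeasure (Measure.count.restrict (c w)) := fun w =>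
    ⟨by rw [Measure.restrict_apply_univ]; exact Measure.count_apply_lt_top.2 (hc w)⟩
  have hopen : ∀ U, IsOpen U → Measurable fun w => Measure.count.restrict (c w) U := by
    intro U hU
    have : (fun w => Measure.count.restrict (c w) U) =
        fun w => (((c w ∩ U).ncard : ℕ) : ℝ≥0∞) := by
      ext w
      have hf : (c w ∩ U).Finite := (hc w).subset inter_subset_left
      rw [Measure.restrict_apply hU.measurableSet, inter_comm,
        Measure.count_apply hf.measurableSet, ← hf.cast_ncard_eq]
      rfl
    rw [this]
    exact measurable_from_top.comp (measurable_ncard_inter_isOpen hc h hU)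
  -- The counting measure of the random set is finite, so measurability of its values passes from
  -- the π-system of open sets to all Borel sets.
  have hmeas : Measurable fun w => (Measure.count : Measure X).restrict (c w) :=
    Measurable.measure_of_isPiSystem (S := {U | IsOpen U}) (BorelSpace.measurable_eq)
      isPiSystem_isOpen hopen (hopen _ isOpen_univ)
  have : {w | c w ∩ B = ∅} = {w | Measure.count.restrict (c w) B = 0} := by
    ext w
    rw [mem_ofPred_eq, mem_ofPred_eq, Measure.restrict_apply hB, Measure.count_eq_zero_iff,
      inter_comm]
  rw [this]
  exact (Measure.measurable_coe hB).comp hmeas (measurableSet_singleton 0)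

/-- A set depending only openly on the points of random finite sets is measurable. -/
theorem measurableSet_of_forall_exists_isOpen {ι : Type*} [Countable ι] {c : ι → Ω → Set X}
    (hc : ∀ k w, (c k w).Finite)
    (h : ∀ k U, IsOpen U → MeasurableSet {w | c k w ∩ U = ∅}) {W : Set Ω}
    (hW : ∀ w ∈ W, ∃ k, ∀ (n : ℕ) (x : Fin n → X), Function.Injective x → range x = c k w →
      ∃ O : Fin n → Set X, (∀ i, IsOpen (O i) ∧ x i ∈ O i) ∧
        ∀ (w' : Ω) (y : Fin n → X), Function.Injective y → range y = c k w' →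
          (∀ i, y i ∈ O i) → w' ∈ W) : MeasurableSet W := by
  -- A countable family of cells: exactly `n` points, and each of `n` basic sets is hit. `W` turns
  -- out to be the union of the cells it contains.
  let A : (Σ (_ : ι) (n : ℕ), Fin n → TopologicalSpace.countableBasis X) → Set Ω := fun p =>
    {w | (c p.1 w ∩ univ).ncard = p.2.1} ∩ ⋂ i, {w | (c p.1 w ∩ p.2.2 i).Nonempty}
  have key : W = ⋃ p ∈ {p | A p ⊆ W}, A p := by
    refine Subset.antisymm (fun w hw => ?_) (iUnion₂_subset fun p hp => hp)
    obtain ⟨k, hk⟩ := hW w hw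
    obtain ⟨n, x, hxi, hxr⟩ := (hc k w).fin_param
    obtain ⟨O, hO, hOW⟩ := hk n x hxi hxr
    obtain ⟨s, hs, hxs⟩ := exists_countableBasis_pairwise_disjoint hxi hO
    have hcard : ∀ y : Fin n → X, Function.Injective y → (range y).ncard = n := fun y hy => by
      rw [← image_univ, ncard_image_of_injective _ hy, ncard_univ,
        Nat.card_eq_fintype_card, Fintype.card_fin]
    refine mem_biUnion (x := ⟨k, n, s⟩) (fun w' hw' => ?_) ⟨?_, ?_⟩
    · obtain ⟨hn, hne⟩ := hw'
      simp only [mem_iInter, mem_ofPred_eq] at hne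
      choose y hyc hys using hne
      have hyi : Function.Injective y := by
        intro i j hij
        by_contra hne
        exact disjoint_left.1 (hs hne) (hys i) (hij ▸ hys j)
      -- The basic sets are disjoint, so the `n` chosen points are distinct and exhaust a set of `n`
      -- points.
      refine hOW w' y hyi ?_ fun i => (hxs i).2 (hys i)
      refine eq_of_subset_of_ncard_le (range_subset_iff.2 hyc) ?_ (hc k w')
      rw [hcard y hyi]
      simpa using hn.le
    · simp [← hxr, hcard x hxi]
    · simp only [mem_iInter, mem_ofPred_eq]
      exact fun i => ⟨x i, hxr ▸ mem_range_self i, (hxs i).1⟩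
  rw [key]
  refine MeasurableSet.biUnion (to_countable _) fun p _ => MeasurableSet.inter ?_ ?_
  · exact measurable_ncard_inter_isOpen (hc p.1) (h p.1) isOpen_univ (measurableSet_singleton _)
  · exact MeasurableSet.iInter fun i => measurableSet_inter_nonempty (h p.1)
      (TopologicalSpace.isOpen_of_mem_countableBasis (p.2.2 i).2)

end RandomSets

/-! ### The Borel sets of finite configurations -/

namespace FiniteConfiguration

variable {X : Type*} [TopologicalSpace X]

theorem isOpen_iff {W : Set (FiniteConfiguration X)} :
    IsOpen W ↔ ∀ n, IsOpen (ofTuple n ⁻¹' W) :=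
  isOpen_sigma_iff

theorem isOpen_inter_nonempty {U : Set X} (hU : IsOpen U) :
    IsOpen {ξ : FiniteConfiguration X | (ξ.carrier ∩ U).Nonempty} := by
  refine isOpen_iff.2 fun n => ?_
  have : ofTuple n ⁻¹' {ξ : FiniteConfiguration X | (ξ.carrier ∩ U).Nonempty} =
      ⋃ i, (fun x : {x : Fin n → X // Function.Injective x} => x.1 i) ⁻¹' U := by
    ext x
    simp [ofTuple, Set.Nonempty]
  rw [this]
  exact isOpen_iUnion fun i => hU.preimage ((continuous_apply i).comp continuous_subtype_val)

variable [T2Space X] [SecondCountableTopology X] [MeasurableSpace X] [BorelSpace X]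

theorem measurableSet_within {B : Set X} (hB : MeasurableSet B) :
    MeasurableSet (within B : Set (FiniteConfiguration X)) := by
  have := measurableSet_inter_eq_empty (c := fun ξ : FiniteConfiguration X => ξ.carrier)
    (fun ξ => ξ.finite) (fun U hU => ?_) hB.compl
  · simpa [within, ← sdiff_eq, sdiff_eq_empty] using this
  · simpa [compl_ofPred, not_nonempty_iff_eq_empty] using
      (isOpen_inter_nonempty hU).measurableSet.compl

/-- The Borel sets of `Γ₀(X)` are generated by the void events. -/
theorem borel_eq_generateFrom_within :
    (inferInstance : MeasurableSpace (FiniteConfiguration X)) =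
      MeasurableSpace.generateFrom {β | ∃ B, MeasurableSet B ∧ within B = β} := by
  apply le_antisymm
  · refine MeasurableSpace.generateFrom_le fun W (hWo : IsOpen W) => ?_
    let m := MeasurableSpace.generateFrom
      {β : Set (FiniteConfiguration X) | ∃ B, MeasurableSet B ∧ within B = β}
    refine @measurableSet_of_forall_exists_isOpen X _ _ _ _ m Unit _
      (fun _ ξ => ξ.carrier) (fun _ ξ => ξ.finite) (fun _ U hU => ?_) W fun ξ hξ => ⟨(), ?_⟩
    · refine MeasurableSpace.measurableSet_generateFrom ⟨Uᶜ, hU.measurableSet.compl, ?_⟩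
      ext ξ
      simp [within, subset_compl_iff_disjoint_right, disjoint_iff_inter_eq_empty]
    · intro n x hxi hxr
      -- On `n`-point configurations `W` is the trace of an open `V` in `Xⁿ`; an open box around `x`
      -- inside `V` supplies the sets `O`.
      obtain ⟨V, hV, hVW⟩ := isOpen_induced_iff.1 (isOpen_iff.1 hWo n)
      have hmem : ∀ (η : FiniteConfiguration X) (y : Fin n → X) (hy : Function.Injective y),
          range y = η.carrier → (y ∈ V ↔ η ∈ W) := by
        intro η y hy hyr
        have h1 : ofTuple n ⟨y, hy⟩ = η := by
          cases η
          simp only [ofTuple, mk.injEq]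
          exact hyr
        have h2 := Set.ext_iff.1 hVW ⟨y, hy⟩
        simpa [h1] using h2
      obtain ⟨O, hO, hOV⟩ := isOpen_pi_iff'.1 hV x ((hmem ξ x hxi hxr).2 hξ)
      exact ⟨O, hO, fun η y hyi hyr hyO => (hmem η y hyi hyr).1 (hOV fun i _ => hyO i)⟩
  · refine MeasurableSpace.generateFrom_le ?_
    rintro _ ⟨B, hB, rfl⟩
    exact measurableSet_within hB

end FiniteConfiguration

/-! ### Void events generate the Borel sets of configurations -/

namespace Configuration

variable {X : Type*} [TopologicalSpace X]

/-- The event that the configuration has no point in `B`. -/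
def void (B : Set X) : Set (Configuration X) :=
  {γ | γ.carrier ∩ B = ∅}

theorem void_union (B C : Set X) : void (B ∪ C) = void B ∩ void C := by
  ext γ
  simp [void, inter_union_distrib_left]

theorem void_iUnion {ι : Type*} (B : ι → Set X) : void (⋃ i, B i) = ⋂ i, void (B i) := by
  ext γ
  simp [void, inter_iUnion]

/-- The void events of Borel sets of compact closure. -/
def voidEvents (X : Type*) [TopologicalSpace X] [MeasurableSpace X] : Set (Set (Configuration X)) :=
  {A | ∃ B : Set X, MeasurableSet B ∧ IsCompact (closure B) ∧ void B = A}

theorem isPiSystem_voidEvents [MeasurableSpace X] : IsPiSystem (voidEvents X) := by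
  rintro _ ⟨B, hB, hBc, rfl⟩ _ ⟨C, hC, hCc, rfl⟩ -
  exact ⟨B ∪ C, hB.union hC, by rw [closure_union]; exact hBc.union hCc, void_union B C⟩

theorem pairing_eq_sum {γ : Configuration X} {f : X → ℝ} {V : Set X} {n : ℕ} {x : Fin n → X}
    (hxi : Function.Injective x) (hxr : range x = γ.carrier ∩ V)
    (hf : Function.support f ⊆ V) : γ.pairing f = ∑ i, f (x i) := by
  rw [pairing, ← finsum_mem_inter_support_eq f (γ.carrier ∩ V) γ.carrier, ← hxr,
    finsum_mem_range hxi, finsum_eq_sum_of_fintype]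
  rw [inter_assoc, inter_eq_self_of_subset_right hf]

theorem pairing_eq_zero_iff {γ : Configuration X} {f : X → ℝ} (hf : HasCompactSupport f)
    (hf0 : ∀ x, 0 ≤ f x) : γ.pairing f = 0 ↔ γ ∈ void (Function.support f) := by
  obtain ⟨n, x, hxi, hxr⟩ := (γ.finite_inter _ hf).fin_param
  rw [pairing_eq_sum hxi hxr (subset_tsupport f),
    Finset.sum_eq_zero_iff_of_nonneg fun i _ => hf0 (x i)]
  constructor
  · intro h
    refine eq_empty_of_forall_notMem fun y hy => hy.2 ?_
    obtain ⟨i, rfl⟩ : y ∈ range x := hxr ▸ ⟨hy.1, subset_tsupport f hy.2⟩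
    exact h i (Finset.mem_univ i)
  · intro h i _
    by_contra hi
    have : x i ∈ γ.carrier ∩ tsupport f := hxr ▸ mem_range_self i
    exact (eq_empty_iff_forall_notMem.1 h (x i)) ⟨this.1, hi⟩

theorem pairing_ofTuple {n : ℕ} (x : {x : Fin n → X // Function.Injective x}) (f : X → ℝ) :
    (FiniteConfiguration.ofTuple n x).toConfiguration.pairing f = ∑ i, f (x.1 i) :=
  pairing_eq_sum x.2 (inter_univ _).symm (subset_univ _)

theorem continuous_pairing_toConfiguration {f : X → ℝ} (hf : Continuous f) :
    Continuous fun ξ : FiniteConfiguration X => ξ.toConfiguration.pairing f := by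
  refine continuous_coinduced_dom.2 (continuous_sigma fun n => ?_)
  simp only [Function.comp_def, pairing_ofTuple]
  exact continuous_finsetSum _ fun i _ =>
    hf.comp ((continuous_apply i).comp continuous_subtype_val)

variable (d : ℕ) [ChartedSpace (EuclideanSpace ℝ (Fin d)) X]

/-- On finite configurations the pairings are continuous for the ordinary topology, being finite
sums over the points. Hence they are Borel on all of `Γ(X)`. -/
theorem ordinaryVagueTopology_le : ordinaryVagueTopology d X ≤ vagueTopology d X := by
  refine sup_le (continuous_iff_coinduced_le.1 ?_) (coinduced_le_iff_le_induced.2 le_rfl)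
  refine continuous_induced_rng.2 (continuous_pi fun f => ?_)
  exact continuous_pairing_toConfiguration f.2.1.continuous

theorem measurable_pairing (f : SmoothTestFunction d X) :
    @Measurable _ _ (configurationBorel d X) _ fun γ : Configuration X => γ.pairing f := by
  have h : @Continuous _ _ (vagueTopology d X) _ fun γ : Configuration X => γ.pairing f :=
    @Continuous.comp _ _ _ (vagueTopology d X) _ _
      (fun (γ : Configuration X) (f : SmoothTestFunction d X) => γ.pairing f) (fun p => p f)
      (continuous_apply (A := fun _ : SmoothTestFunction d X => ℝ) f) continuous_induced_dom
  let := ordinaryVagueTopology d X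
  let := configurationBorel d X
  have : BorelSpace (Configuration X) := ⟨rfl⟩
  exact (continuous_le_dom (ordinaryVagueTopology_le d) h).measurable

variable [T2Space X] [SecondCountableTopology X] [IsManifold (𝓡 d) ∞ X]

/-- The smooth structure enters here: `U` is the nonvanishing set of some smooth `f ≥ 0`, and a sum
of values of `f` is zero only if no point lies in `U`. -/
theorem measurableSet_void_isOpen {U : Set X} (hU : IsOpen U) (hUc : IsCompact (closure U)) :
    MeasurableSet[configurationBorel d X] (void U) := by
  have : LocallyCompactSpace X := ChartedSpace.locallyCompactSpace (EuclideanSpace ℝ (Fin d)) X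
  obtain ⟨f, hfU, hf, hf0⟩ := hU.exists_contMDiff_support_eq (n := ⊤) (𝓡 d)
  have hfc : HasCompactSupport f := by rwa [HasCompactSupport, tsupport, hfU]
  have : void U = (fun γ : Configuration X => γ.pairing f) ⁻¹' {0} := by
    ext γ
    rw [mem_preimage, mem_singleton_iff, pairing_eq_zero_iff hfc hf0, hfU]
  rw [this]
  exact measurable_pairing d ⟨f, hf, hfc⟩ (measurableSet_singleton 0)

variable [MeasurableSpace X] [BorelSpace X]

theorem measurableSet_void_of_isCompact_closure {B : Set X} (hB : MeasurableSet B)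
    (hBc : IsCompact (closure B)) : MeasurableSet[configurationBorel d X] (void B) := by
  have : LocallyCompactSpace X := ChartedSpace.locallyCompactSpace (EuclideanSpace ℝ (Fin d)) X
  obtain ⟨V, hBV, hV, hVc⟩ : ∃ V, closure B ⊆ V ∧ IsOpen V ∧ IsCompact (closure V) := by
    obtain ⟨K, hK, hBK⟩ := exists_compact_superset hBc
    exact ⟨interior K, hBK, isOpen_interior,
      hK.of_isClosed_subset isClosed_closure (closure_minimal interior_subset hK.isClosed)⟩
  -- Cutting down to the relatively compact neighbourhood `V` makes the random set finite without
  -- changing its points in `B`.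
  have h := @measurableSet_inter_eq_empty X _ _ _ (Configuration X) (configurationBorel d X)
    (fun γ => γ.carrier ∩ V) _ _
    (fun γ => (γ.finite_inter _ hVc).subset (inter_subset_inter_right _ subset_closure))
    (fun U hU => ?_) B hB
  · simpa only [void, inter_assoc, inter_eq_self_of_subset_right (subset_closure.trans hBV)]
      using h
  · simp only [inter_assoc]
    exact measurableSet_void_isOpen d (hV.inter hU)
      (hVc.of_isClosed_subset isClosed_closure (closure_mono inter_subset_left))

section Generation

omit [ChartedSpace (EuclideanSpace ℝ (Fin d)) X] [IsManifold (𝓡 d) ∞ X]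

variable [LocallyCompactSpace X]

theorem measurableSet_void {B : Set X} (hB : MeasurableSet B) :
    MeasurableSet[MeasurableSpace.generateFrom (voidEvents X)] (void B) := by
  let K : CompactExhaustion X := default
  have : void B = ⋂ k, void (B ∩ K k) := by
    rw [← void_iUnion, ← inter_iUnion, K.iUnion_eq, inter_univ]
  rw [this]
  refine MeasurableSet.iInter fun k => MeasurableSpace.measurableSet_generateFrom
    ⟨B ∩ K k, hB.inter (K.isCompact k).measurableSet, ?_, rfl⟩
  exact (K.isCompact k).of_isClosed_subset isClosed_closure
    (closure_minimal inter_subset_right (K.isCompact k).isClosed)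

/-- A configuration is finite iff it avoids the complement of some member of a compact exhaustion.
-/
theorem measurableSet_finite :
    MeasurableSet[MeasurableSpace.generateFrom (voidEvents X)]
      {γ : Configuration X | γ.carrier.Finite} := by
  let K : CompactExhaustion X := default
  have : {γ : Configuration X | γ.carrier.Finite} = ⋃ k, void (K k)ᶜ := by
    ext γ
    simp only [mem_ofPred_eq, mem_iUnion, void, ← sdiff_eq, sdiff_eq_empty]
    constructor
    · exact fun h => K.exists_superset_of_isCompact h.isCompact
    · rintro ⟨k, hk⟩
      exact (γ.finite_inter _ (K.isCompact k)).subset (subset_inter Subset.rfl hk)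
  rw [this]
  exact MeasurableSet.iUnion fun k => measurableSet_void (K.isCompact k).measurableSet.compl

theorem measurable_toConfiguration_comap :
    (inferInstance : MeasurableSpace (FiniteConfiguration X)) ≤
      (MeasurableSpace.generateFrom (voidEvents X)).comap
        FiniteConfiguration.toConfiguration := by
  rw [FiniteConfiguration.borel_eq_generateFrom_within]
  refine MeasurableSpace.generateFrom_le ?_
  rintro _ ⟨B, hB, rfl⟩
  refine ⟨void Bᶜ, measurableSet_void hB.compl, ?_⟩
  ext ξ
  simp [void, FiniteConfiguration.toConfiguration, FiniteConfiguration.within, ← sdiff_eq,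
    sdiff_eq_empty]

theorem measurable_proj {Y : Set X} (hY : IsCompact (closure Y)) (hYm : MeasurableSet Y) :
    @Measurable _ _ (MeasurableSpace.generateFrom (voidEvents X)) _ (proj Y hY) := by
  refine measurable_iff_le_map.2 (FiniteConfiguration.borel_eq_generateFrom_within.le.trans
    (MeasurableSpace.generateFrom_le ?_))
  rintro _ ⟨B, hB, rfl⟩
  have : proj Y hY ⁻¹' FiniteConfiguration.within B = void (Y ∩ Bᶜ) := by
    ext γ
    change γ.carrier ∩ Y ⊆ B ↔ γ.carrier ∩ (Y ∩ Bᶜ) = ∅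
    rw [← inter_assoc, ← sdiff_eq, sdiff_eq_empty]
  rw [MeasurableSpace.map_def, this]
  exact measurableSet_void (hYm.inter hB.compl)

end Generation

variable [LocallyCompactSpace X]

omit [IsManifold (𝓡 d) ∞ X] in
-- A basic vague neighbourhood tests finitely many functions, whose supports lie in one compact `K
-- k`. Their pairings are continuous functions of the finitely many points in `K k`.
theorem measurableSet_of_isOpen_vagueTopology {W : Set (Configuration X)}
    (hW : @IsOpen _ (vagueTopology d X) W) :
    MeasurableSet[MeasurableSpace.generateFrom (voidEvents X)] W := by
  let m := MeasurableSpace.generateFrom (voidEvents X)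
  let K : CompactExhaustion X := default
  refine @measurableSet_of_forall_exists_isOpen X _ _ _ _ m ℕ _ (fun k γ => γ.carrier ∩ K k)
    (fun k γ => γ.finite_inter _ (K.isCompact k)) (fun k U hU => ?_) W fun γ hγ => ?_
  · simp only [inter_assoc]
    exact measurableSet_void ((K.isCompact k).measurableSet.inter hU.measurableSet)
  · obtain ⟨V, hV, rfl⟩ := isOpen_induced_iff.1 hW
    obtain ⟨I, u, hu, huV⟩ := isOpen_pi_iff.1 hV _ hγ
    obtain ⟨k, hk⟩ := K.exists_superset_of_isCompact
      (I.isCompact_biUnion fun f _ => f.2.2 : IsCompact (⋃ f ∈ I, tsupport f.1))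
    refine ⟨k, fun n x hxi hxr => ?_⟩
    have hsum : ∀ (η : Configuration X) (y : Fin n → X), Function.Injective y →
        range y = η.carrier ∩ K k → ∀ f ∈ I, η.pairing f = ∑ i, f.1 (y i) := fun η y hyi hyr f hf =>
      pairing_eq_sum hyi hyr ((subset_tsupport f.1).trans
        ((subset_biUnion_of_mem (u := fun f : SmoothTestFunction d X => tsupport f.1) hf).trans hk))
    have hopen : IsOpen (⋂ f ∈ I, (fun y : Fin n → X => ∑ i, f.1 (y i)) ⁻¹' u f) :=
      isOpen_biInter_finset fun f hf => (hu f hf).1.preimage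
        (continuous_finsetSum _ fun i _ => f.2.1.continuous.comp (continuous_apply i))
    obtain ⟨O, hO, hOu⟩ := isOpen_pi_iff'.1 hopen x (mem_iInter₂.2 fun f hf => by
      rw [mem_preimage, ← hsum γ x hxi hxr f hf]
      exact (hu f hf).2)
    refine ⟨O, hO, fun η y hyi hyr hyO => huV fun f hf => ?_⟩
    have := mem_iInter₂.1 (hOu fun i _ => hyO i) f hf
    rwa [mem_preimage, ← hsum η y hyi hyr f hf] at this

/-- The Borel `σ`-algebra of the ordinary-vague topology is generated by the void events. -/
theorem configurationBorel_eq_generateFrom :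
    configurationBorel d X = MeasurableSpace.generateFrom (voidEvents X) := by
  apply le_antisymm
  · refine MeasurableSpace.generateFrom_le fun W hW => ?_
    obtain ⟨hW₀, hW₁⟩ := hW
    obtain ⟨A, hA, hAW⟩ := measurable_toConfiguration_comap _
      (IsOpen.measurableSet (s := FiniteConfiguration.toConfiguration ⁻¹' W) hW₀)
    obtain ⟨V, hV, hVW⟩ := hW₁
    -- The two summands of the topology are separated by a generated set, so each part of `W` can be
    -- treated alone.
    have : W = A ∩ {γ | γ.carrier.Finite} ∪ V ∩ {γ | γ.carrier.Finite}ᶜ := by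
      ext γ
      by_cases hγ : γ.carrier.Finite
      · have := Set.ext_iff.1 hAW ⟨γ.carrier, hγ⟩
        simp only [mem_preimage, FiniteConfiguration.toConfiguration] at this
        simp [hγ, this]
      · have := Set.ext_iff.1 hVW ⟨γ, hγ⟩
        simp only [mem_preimage] at this
        simp [hγ, this]
    rw [this]
    exact (hA.inter measurableSet_finite).union
      ((measurableSet_of_isOpen_vagueTopology d hV).inter measurableSet_finite.compl)
  · refine MeasurableSpace.generateFrom_le ?_
    rintro _ ⟨B, hB, hBc, rfl⟩
    exact measurableSet_void_of_isCompact_closure d hB hBc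

end Configuration

/-! ### The Poisson measure in finite volume -/

theorem FiniteConfiguration.isPiSystem_within {X : Type*} [MeasurableSpace X] :
    IsPiSystem {β : Set (FiniteConfiguration X) |
      ∃ B, MeasurableSet B ∧ FiniteConfiguration.within B = β} := by
  rintro _ ⟨B, hB, rfl⟩ _ ⟨C, hC, rfl⟩ -
  refine ⟨B ∩ C, hB.inter hC, ?_⟩
  ext ξ
  simp [FiniteConfiguration.within]

section FiniteVolume

variable {X : Type*} [TopologicalSpace X] [MeasurableSpace X]

/-- The Poisson measure `e^{-σ(Y)} λ` on the finite configurations in `Y`. -/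
noncomputable def finitePoisson (σ : Measure X) (Y : Set X) : Measure (FiniteConfiguration X) :=
  ENNReal.ofReal (Real.exp (-(σ Y).toReal)) •
    (lebesguePoisson σ).restrict (FiniteConfiguration.within Y)

variable [T2Space X] [SecondCountableTopology X] [BorelSpace X] (σ : Measure X)

/-- The indicator of `within Z` is multiplicative over points, so its integral is the exponential
series of `σ Z`. -/
theorem lebesguePoisson_within [SigmaFinite σ] [NullSingletonClass σ] {Z : Set X}
    (hZ : MeasurableSet Z) (hσZ : σ Z ≠ ⊤) :
    lebesguePoisson σ (FiniteConfiguration.within Z) =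
      ENNReal.ofReal (Real.exp (σ Z).toReal) := by
  have hm := FiniteConfiguration.measurableSet_within hZ
  rw [← lintegral_indicator_one hm, lintegral_lebesguePoisson σ (measurable_one.indicator hm)
    (measurable_one.indicator hZ) fun n x => ?_, lintegral_indicator_one hZ,
    tsum_inv_factorial_mul_pow _ hσZ]
  classical
  simp only [indicator_apply, Pi.one_apply, Finset.prod_ite_zero, Finset.prod_const_one]
  congr 1
  simp [FiniteConfiguration.within, FiniteConfiguration.ofTuple, range_subset_iff]

/-- Configurations in `Y` avoiding `B` are those in `Y \ B`, and `e^{-σ(Y)} e^{σ(Y \ B)} = e^{-σ(Y ∩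
B)}`. -/
theorem finitePoisson_within_compl [SigmaFinite σ] [NullSingletonClass σ] {Y B : Set X}
    (hY : MeasurableSet Y) (hσY : σ Y ≠ ⊤) (hB : MeasurableSet B) :
    finitePoisson σ Y (FiniteConfiguration.within Bᶜ) =
      ENNReal.ofReal (Real.exp (-(σ (Y ∩ B)).toReal)) := by
  have h : FiniteConfiguration.within Bᶜ ∩ FiniteConfiguration.within Y =
      FiniteConfiguration.within (Y \ B) := by
    ext ξ
    simp [FiniteConfiguration.within, sdiff_eq, and_comm]
  have hσ : σ (Y \ B) ≠ ⊤ := measure_ne_top_of_subset sdiff_subset hσY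
  rw [finitePoisson, Measure.smul_apply,
    Measure.restrict_apply (FiniteConfiguration.measurableSet_within hB.compl), h,
    lebesguePoisson_within σ (hY.diff hB) hσ, smul_eq_mul,
    ← ENNReal.ofReal_mul (Real.exp_pos _).le, ← Real.exp_add]
  congr 2
  rw [← measure_inter_add_sdiff Y hB, ENNReal.toReal_add
    (measure_ne_top_of_subset inter_subset_left hσY) hσ]
  ring

theorem isProbabilityMeasure_finitePoisson [SigmaFinite σ] [NullSingletonClass σ] {Y : Set X}
    (hY : MeasurableSet Y) (hσY : σ Y ≠ ⊤) : IsProbabilityMeasure (finitePoisson σ Y) := by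
  constructor
  have h := finitePoisson_within_compl σ hY hσY MeasurableSet.empty
  simpa [FiniteConfiguration.within] using h

end FiniteVolume

/-! ### Construction by independent superposition -/

namespace Configuration

variable {X : Type*} [TopologicalSpace X]

/-- The superposition of the parts of finite configurations in the cells of a locally finite
partition. -/
def superpose (Y : ℕ → Set X)
    (hY : ∀ Λ : Set X, IsCompact Λ → {k | (Y k ∩ Λ).Nonempty}.Finite)
    (ξ : ℕ → FiniteConfiguration X) : Configuration X where
  -- Intersecting with `Y k` defines the map on all sequences; under `finitePoisson σ (Y k)` it
  -- almost surely discards nothing.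
  carrier := ⋃ k, (ξ k).carrier ∩ Y k
  finite_inter Λ hΛ := by
    refine ((hY Λ hΛ).biUnion fun k _ => (ξ k).finite).subset ?_
    rintro x ⟨hx, hxΛ⟩
    obtain ⟨k, hxk, hxY⟩ := mem_iUnion.1 hx
    exact mem_biUnion (x := k) ⟨x, hxY, hxΛ⟩ hxk

/-- Only the finitely many cells meeting `B` matter, so the preimage is a cylinder, whose product
measure is a finite product. -/
theorem superpose_preimage_void (Y : ℕ → Set X)
    (hY : ∀ Λ : Set X, IsCompact Λ → {k | (Y k ∩ Λ).Nonempty}.Finite) {B : Set X}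
    {s : Finset ℕ} (hs : ∀ k, k ∉ s → Y k ∩ B = ∅) :
    superpose Y hY ⁻¹' void B =
      (s : Set ℕ).pi fun k => FiniteConfiguration.within (Y k ∩ B)ᶜ := by
  ext ξ
  simp only [mem_preimage, void, superpose, mem_ofPred_eq, mem_pi, FiniteConfiguration.within,
    iUnion_inter, iUnion_eq_empty, subset_compl_iff_disjoint_right, disjoint_iff_inter_eq_empty,
    inter_assoc, Finset.mem_coe]
  refine ⟨fun h k _ => h k, fun h k => ?_⟩
  by_cases hk : k ∈ s
  · exact h k hk
  · rw [hs k hk, inter_empty]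

variable [T2Space X] [SecondCountableTopology X] [LocallyCompactSpace X] [MeasurableSpace X]
  [BorelSpace X]

/-- The cells are the successive differences of a compact exhaustion; a compact set inside `K m`
misses all cells of index above `m`. -/
theorem exists_locallyFinite_partition (X : Type*) [TopologicalSpace X] [T2Space X]
    [SecondCountableTopology X] [LocallyCompactSpace X] [MeasurableSpace X] [BorelSpace X] :
    ∃ Y : ℕ → Set X, (∀ k, MeasurableSet (Y k)) ∧ Pairwise (Function.onFun Disjoint Y) ∧
      ⋃ k, Y k = univ ∧ (∀ k, ∃ Λ, IsCompact Λ ∧ Y k ⊆ Λ) ∧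
      ∀ Λ : Set X, IsCompact Λ → {k | (Y k ∩ Λ).Nonempty}.Finite := by
  let K : CompactExhaustion X := default
  refine ⟨disjointed K, fun k => MeasurableSet.disjointed
    (fun i => (K.isCompact i).measurableSet) k, disjoint_disjointed K,
    by rw [iUnion_disjointed, K.iUnion_eq], fun k => ⟨K k, K.isCompact k, disjointed_subset K k⟩,
    fun Λ hΛ => ?_⟩
  obtain ⟨m, hm⟩ := K.exists_superset_of_isCompact hΛ
  refine (finite_Iic m).subset ?_
  rintro k ⟨x, hxk, hxΛ⟩
  by_contra hk
  rw [mem_Iic, not_le] at hk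
  rw [disjointed_eq_inter_compl] at hxk
  exact mem_iInter₂.1 hxk.2 m hk (hm hxΛ)

/-- By independence the void probabilities of the cells multiply, and the exponents `σ (Y k ∩ B)`
add up to `σ B`. -/
theorem exists_measure_void (σ : Measure X) [IsLocallyFiniteMeasure σ] [NullSingletonClass σ] :
    ∃ π : @Measure (Configuration X) (MeasurableSpace.generateFrom (voidEvents X)),
      IsProbabilityMeasure π ∧ ∀ B : Set X, MeasurableSet B → IsCompact (closure B) →
        π (void B) = ENNReal.ofReal (Real.exp (-(σ B).toReal)) := by
  let m := MeasurableSpace.generateFrom (voidEvents X)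
  obtain ⟨Y, hYm, hYd, hYu, hYc, hYf⟩ := exists_locallyFinite_partition X
  have hσY : ∀ k, σ (Y k) ≠ ⊤ := fun k => by
    obtain ⟨Λ, hΛ, hYΛ⟩ := hYc k
    exact measure_ne_top_of_subset hYΛ hΛ.measure_lt_top.ne
  have hP : ∀ k, IsProbabilityMeasure (finitePoisson σ (Y k)) := fun k =>
    isProbabilityMeasure_finitePoisson σ (hYm k) (hσY k)
  have hpre : ∀ B : Set X, IsCompact (closure B) → ∃ s : Finset ℕ,
      (∀ k, k ∉ s → Y k ∩ B = ∅) ∧ superpose Y hYf ⁻¹' void B =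
        (s : Set ℕ).pi fun k => FiniteConfiguration.within (Y k ∩ B)ᶜ := by
    intro B hBc
    have hs : ∀ k, k ∉ (hYf _ hBc).toFinset → Y k ∩ B = ∅ := by
      intro k hk
      simp only [Finite.mem_toFinset, mem_ofPred_eq, not_nonempty_iff_eq_empty] at hk
      exact subset_empty_iff.1 (hk ▸ inter_subset_inter_right _ subset_closure)
    exact ⟨_, hs, superpose_preimage_void Y hYf hs⟩
  have hmeas : Measurable (superpose Y hYf) := by
    refine measurable_generateFrom ?_
    rintro _ ⟨B, hB, hBc, rfl⟩
    obtain ⟨s, -, hs⟩ := hpre B hBc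
    rw [hs]
    exact MeasurableSet.pi (to_countable _) fun k _ =>
      FiniteConfiguration.measurableSet_within ((hYm k).inter hB).compl
  refine ⟨(Measure.infinitePi fun k => finitePoisson σ (Y k)).map (superpose Y hYf),
    Measure.isProbabilityMeasure_map hmeas.aemeasurable, fun B hB hBc => ?_⟩
  obtain ⟨s, hsB, hs⟩ := hpre B hBc
  have hσB : ∀ k, σ (Y k ∩ B) ≠ ⊤ := fun k =>
    measure_ne_top_of_subset inter_subset_left (hσY k)
  rw [Measure.map_apply hmeas (MeasurableSpace.measurableSet_generateFrom ⟨B, hB, hBc, rfl⟩), hs,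
    Measure.infinitePi_pi _ fun k _ =>
      FiniteConfiguration.measurableSet_within ((hYm k).inter hB).compl]
  simp_rw [fun k => finitePoisson_within_compl σ (hYm k) (hσY k) ((hYm k).inter hB),
    ← inter_assoc, inter_self]
  rw [← ENNReal.ofReal_prod_of_nonneg fun k _ => (Real.exp_pos _).le, ← Real.exp_sum,
    Finset.sum_neg_distrib, ← ENNReal.toReal_sum fun k _ => hσB k]
  congr 4
  have hB_eq : B = ⋃ k ∈ s, Y k ∩ B := by
    refine Subset.antisymm (fun x hx => ?_) (iUnion₂_subset fun k _ => inter_subset_right)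
    obtain ⟨k, hk⟩ := mem_iUnion.1 (hYu ▸ mem_univ x : x ∈ ⋃ k, Y k)
    refine mem_biUnion (x := k) ?_ ⟨hk, hx⟩
    by_contra hks
    exact eq_empty_iff_forall_notMem.1 (hsB k hks) x ⟨hk, hx⟩
  conv_rhs => rw [hB_eq]
  exact (measure_biUnion_finset (fun i _ j _ hij =>
    (hYd hij).mono inter_subset_left inter_subset_left) fun k _ => (hYm k).inter hB).symm

end Configuration

/-! ### Projections to finite volume -/

namespace Configuration

variable {X : Type*} [TopologicalSpace X]

theorem void_eq_preimage_proj {Y : Set X} (hY : IsCompact (closure Y)) :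
    void Y = proj Y hY ⁻¹' FiniteConfiguration.within Yᶜ := by
  ext γ
  change _ ↔ γ.carrier ∩ Y ⊆ Yᶜ
  rw [subset_compl_iff_disjoint_right, disjoint_iff_inter_eq_empty, inter_assoc, inter_self]
  rfl

theorem preimage_proj_within {Y : Set X} (hY : IsCompact (closure Y)) (B : Set X) :
    proj Y hY ⁻¹' FiniteConfiguration.within Bᶜ = void (Y ∩ B) := by
  ext γ
  change γ.carrier ∩ Y ⊆ Bᶜ ↔ γ.carrier ∩ (Y ∩ B) = ∅
  rw [subset_compl_iff_disjoint_right, disjoint_iff_inter_eq_empty, inter_assoc]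

theorem preimage_proj_inter_within {Y : Set X} (hY : IsCompact (closure Y))
    (β : Set (FiniteConfiguration X)) :
    proj Y hY ⁻¹' (β ∩ FiniteConfiguration.within Y) = proj Y hY ⁻¹' β := by
  ext γ
  exact and_iff_left inter_subset_right

theorem pairing_proj {f : X → ℝ} {Y : Set X} (hY : IsCompact (closure Y))
    (hf : Function.support f ⊆ Y) (γ : Configuration X) :
    (proj Y hY γ).toConfiguration.pairing f = γ.pairing f := by
  have : (proj Y hY γ).carrier = γ.carrier ∩ Y := rfl
  rw [pairing, pairing, ← finsum_mem_inter_support_eq f (γ.carrier ∩ Y) γ.carrier]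
  · rfl
  · rw [inter_assoc, inter_eq_self_of_subset_right hf]

end Configuration

/-! ### Existence, uniqueness and Laplace transform -/

section Poisson

open Configuration

variable {d : ℕ} {X : Type*} [TopologicalSpace X] [T2Space X]
    [SecondCountableTopology X] [ChartedSpace (EuclideanSpace ℝ (Fin d)) X]
    [IsManifold (𝓡 d) ∞ X] [LocallyCompactSpace X] [MeasurableSpace X] [BorelSpace X]
    {σ : Measure X} {π : @Measure (Configuration X) (configurationBorel d X)}

theorem measurable_proj_configurationBorel (d : ℕ) [ChartedSpace (EuclideanSpace ℝ (Fin d)) X]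
    [IsManifold (𝓡 d) ∞ X] {Y : Set X} (hY : IsCompact (closure Y))
    (hYm : MeasurableSet Y) : @Measurable _ _ (configurationBorel d X) _ (proj Y hY) := by
  rw [configurationBorel_eq_generateFrom d]
  exact measurable_proj hY hYm

theorem IsPoissonMeasure.map_proj (hπ : IsPoissonMeasure d σ π) {Y : Set X}
    (hY : IsCompact (closure Y)) (hYm : MeasurableSet Y) :
    @Measure.map _ _ (configurationBorel d X) _ (proj Y hY) π = finitePoisson σ Y := by
  let := configurationBorel d X
  ext β hβ
  rw [Measure.map_apply (measurable_proj_configurationBorel d hY hYm) hβ,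
    ← preimage_proj_inter_within, hπ.proj_eq Y hY hYm β hβ, finitePoisson, Measure.smul_apply,
    Measure.restrict_apply hβ, smul_eq_mul]

theorem IsPoissonMeasure.apply_void [IsLocallyFiniteMeasure σ] [NullSingletonClass σ]
    (hπ : IsPoissonMeasure d σ π) {B : Set X} (hB : MeasurableSet B) (hBc : IsCompact (closure B)) :
    π (void B) = ENNReal.ofReal (Real.exp (-(σ B).toReal)) := by
  let := configurationBorel d X
  have hσ : σ B ≠ ⊤ := measure_ne_top_of_subset subset_closure hBc.measure_lt_top.ne
  rw [void_eq_preimage_proj hBc, ← Measure.map_apply (measurable_proj_configurationBorel d hBc hB)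
    (FiniteConfiguration.measurableSet_within hB.compl), hπ.map_proj hBc hB,
    finitePoisson_within_compl σ hB hσ hB, inter_self]

/-- A Poisson measure is characterised by its void probabilities. -/
theorem IsPoissonMeasure.of_void [IsLocallyFiniteMeasure σ] [NullSingletonClass σ]
    (hπ : IsProbabilityMeasure π)
    (h : ∀ B : Set X, MeasurableSet B → IsCompact (closure B) →
      π (void B) = ENNReal.ofReal (Real.exp (-(σ B).toReal))) : IsPoissonMeasure d σ π := by
  refine ⟨hπ, fun Y hY hYm β hβ => ?_⟩
  let := configurationBorel d X
  have hσ : σ Y ≠ ⊤ := measure_ne_top_of_subset subset_closure hY.measure_lt_top.ne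
  have hm := measurable_proj_configurationBorel d hY hYm
  have hprob := Measure.isProbabilityMeasure_map (μ := π) hm.aemeasurable
  have hprob' := isProbabilityMeasure_finitePoisson σ hYm hσ
  have hmap : π.map (proj Y hY) = finitePoisson σ Y := by
    -- Both are probability measures, so comparison on the generating π-system suffices; there the
    -- preimage under the projection is the void event of `Y ∩ Bᶜ`.
    refine ext_of_generate_finite _ FiniteConfiguration.borel_eq_generateFrom_within
      FiniteConfiguration.isPiSystem_within ?_ (by rw [measure_univ, measure_univ])
    rintro _ ⟨B, hB, rfl⟩
    rw [Measure.map_apply hm (FiniteConfiguration.measurableSet_within hB), ← compl_compl B,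
      preimage_proj_within, finitePoisson_within_compl σ hYm hσ hB.compl]
    exact h _ (hYm.inter hB.compl)
      (hY.of_isClosed_subset isClosed_closure (closure_mono inter_subset_left))
  rw [preimage_proj_inter_within, ← Measure.map_apply hm hβ, hmap, finitePoisson,
    Measure.smul_apply, Measure.restrict_apply hβ, smul_eq_mul]

theorem IsPoissonMeasure.unique [IsLocallyFiniteMeasure σ] [NullSingletonClass σ]
    {π' : @Measure (Configuration X) (configurationBorel d X)}
    (hπ : IsPoissonMeasure d σ π) (hπ' : IsPoissonMeasure d σ π') : π = π' := by
  let := configurationBorel d X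
  have := hπ.isProbabilityMeasure
  have := hπ'.isProbabilityMeasure
  refine ext_of_generate_finite _ (configurationBorel_eq_generateFrom d) isPiSystem_voidEvents ?_
    (by rw [measure_univ, measure_univ])
  rintro _ ⟨B, hB, hBc, rfl⟩
  rw [hπ.apply_void hB hBc, hπ'.apply_void hB hBc]

theorem exists_isPoissonMeasure (d : ℕ) [ChartedSpace (EuclideanSpace ℝ (Fin d)) X]
    [IsManifold (𝓡 d) ∞ X] (σ : Measure X) [IsLocallyFiniteMeasure σ] [NullSingletonClass σ] :
    ∃ π : @Measure (Configuration X) (configurationBorel d X), IsPoissonMeasure d σ π := by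
  have h : ∃ π : @Measure (Configuration X) (configurationBorel d X),
      IsProbabilityMeasure π ∧ ∀ B : Set X, MeasurableSet B → IsCompact (closure B) →
        π (void B) = ENNReal.ofReal (Real.exp (-(σ B).toReal)) := by
    rw [configurationBorel_eq_generateFrom d]
    exact exists_measure_void σ
  obtain ⟨π, hπ, hv⟩ := h
  exact ⟨π, .of_void hπ hv⟩

omit [LocallyCompactSpace X] in
-- On `within Y` the integrand is the product of `e^f · 1_Y` over the points. Its `λ`-integral is
-- `exp (∫_Y e^f dσ)`, and the normalisation `e^{-σ(Y)}` contributes the `-1`.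
theorem lintegral_exp_pairing_finitePoisson [IsLocallyFiniteMeasure σ] [NullSingletonClass σ]
    {f : X → ℝ} (hf : Continuous f) {Y : Set X} (hY : IsCompact Y) :
    ∫⁻ ξ, ENNReal.ofReal (Real.exp (ξ.toConfiguration.pairing f)) ∂(finitePoisson σ Y) =
      ENNReal.ofReal (Real.exp (∫ x in Y, (Real.exp (f x) - 1) ∂σ)) := by
  classical
  have hYm := hY.measurableSet
  have hW := FiniteConfiguration.measurableSet_within hYm
  have hg : Measurable fun x => ENNReal.ofReal (Real.exp (f x)) :=
    (Real.continuous_exp.comp hf).measurable.ennreal_ofReal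
  have hG : Measurable fun ξ : FiniteConfiguration X =>
      ENNReal.ofReal (Real.exp (ξ.toConfiguration.pairing f)) :=
    (Real.continuous_exp.comp (continuous_pairing_toConfiguration hf)).measurable.ennreal_ofReal
  have hint : IntegrableOn (fun x => Real.exp (f x)) Y σ :=
    (Real.continuous_exp.comp hf).continuousOn.integrableOn_compact hY
  have hI : ∫⁻ x, Y.indicator (fun x => ENNReal.ofReal (Real.exp (f x))) x ∂σ =
      ENNReal.ofReal (∫ x in Y, Real.exp (f x) ∂σ) := by
    rw [lintegral_indicator hYm, ofReal_integral_eq_lintegral_ofReal hint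
      (Filter.Eventually.of_forall fun x => (Real.exp_pos _).le)]
  rw [finitePoisson, lintegral_smul_measure, ← lintegral_indicator hW,
    lintegral_lebesguePoisson σ (hG.indicator hW) (hg.indicator hYm) fun n x => ?_, hI,
    tsum_inv_factorial_mul_pow _ ENNReal.ofReal_ne_top, smul_eq_mul,
    ← ENNReal.ofReal_mul (Real.exp_pos _).le, ← Real.exp_add,
    ENNReal.toReal_ofReal (integral_nonneg fun x => (Real.exp_pos _).le),
    integral_sub hint (integrableOn_const hY.measure_lt_top.ne), setIntegral_const]
  · congr 2
    simp only [Measure.real, smul_eq_mul, mul_one]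
    ring
  · simp only [indicator_apply, Finset.prod_ite_zero, pairing_ofTuple, Real.exp_sum]
    rw [ENNReal.ofReal_prod_of_nonneg fun i _ => (Real.exp_pos _).le]
    have h : FiniteConfiguration.ofTuple n x ∈ FiniteConfiguration.within Y ↔
        ∀ i ∈ Finset.univ, x.1 i ∈ Y := by
      simp [FiniteConfiguration.within, FiniteConfiguration.ofTuple, range_subset_iff]
    by_cases hx : ∀ i ∈ Finset.univ, x.1 i ∈ Y
    · rw [if_pos (h.2 hx), if_pos hx]
    · rw [if_neg (mt h.1 hx), if_neg hx]

/-- The pairing sees only the points in `tsupport f`, which reduces to finite volume, and `e^f - 1`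
vanishes elsewhere, so the local integral is the global one. -/
theorem IsPoissonMeasure.lintegral_exp_pairing [IsLocallyFiniteMeasure σ] [NullSingletonClass σ]
    (hπ : IsPoissonMeasure d σ π) {f : X → ℝ} (hf : Continuous f) (hfc : HasCompactSupport f) :
    @lintegral _ (configurationBorel d X) π (fun γ => ENNReal.ofReal (Real.exp (γ.pairing f))) =
      ENNReal.ofReal (Real.exp (∫ x, (Real.exp (f x) - 1) ∂σ)) := by
  let := configurationBorel d X
  have hY : IsCompact (closure (tsupport f)) := by rwa [(isClosed_tsupport f).closure_eq]
  have hYm := (isClosed_tsupport f).measurableSet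
  have hG : Measurable fun ξ : FiniteConfiguration X =>
      ENNReal.ofReal (Real.exp (ξ.toConfiguration.pairing f)) :=
    (Real.continuous_exp.comp (continuous_pairing_toConfiguration hf)).measurable.ennreal_ofReal
  have hproj : ∫⁻ γ, ENNReal.ofReal (Real.exp (γ.pairing f)) ∂π =
      ∫⁻ γ, ENNReal.ofReal (Real.exp
        ((proj (tsupport f) hY γ).toConfiguration.pairing f)) ∂π :=
    lintegral_congr fun γ => by rw [pairing_proj hY (subset_tsupport f)]
  rw [hproj, ← lintegral_map hG (measurable_proj_configurationBorel d hY hYm), hπ.map_proj hY hYm,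
    lintegral_exp_pairing_finitePoisson hf hfc,
    setIntegral_eq_integral_of_forall_compl_eq_zero fun x hx => ?_]
  rw [image_eq_zero_of_notMem_tsupport hx, Real.exp_zero, sub_self]

end Poisson

theorem mainTheorem3 (d : ℕ) {X : Type*} [TopologicalSpace X] [T2Space X]
    [SecondCountableTopology X] [ConnectedSpace X] [NoncompactSpace X]
    [ChartedSpace (EuclideanSpace ℝ (Fin d)) X] [IsManifold (𝓡 d) ∞ X]
    [MeasurableSpace X] [BorelSpace X] (σ : Measure X) [IsLocallyFiniteMeasure σ]
    [σ.IsOpenPosMeasure] (hσ₀ : ∀ x : X, σ {x} = 0) (hσ : σ univ = ⊤) :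
    (∃! π : @Measure (Configuration X) (configurationBorel d X), IsPoissonMeasure d σ π) ∧
    ∀ π : @Measure (Configuration X) (configurationBorel d X), IsPoissonMeasure d σ π →
      ∀ f : SmoothTestFunction d X,
        Integrable (fun γ : Configuration X => Real.exp (γ.pairing f)) π ∧
        Integrable (fun x : X => Real.exp (f x) - 1) σ ∧
        ∫ γ, Real.exp (γ.pairing f) ∂π = Real.exp (∫ x, (Real.exp (f x) - 1) ∂σ) := by
  have : LocallyCompactSpace X := ChartedSpace.locallyCompactSpace (EuclideanSpace ℝ (Fin d)) X
  have : NullSingletonClass σ := ⟨hσ₀⟩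
  refine ⟨?_, fun π hπ f => ?_⟩
  · obtain ⟨π, hπ⟩ := exists_isPoissonMeasure d σ
    exact ⟨π, hπ, fun π' hπ' => hπ'.unique hπ⟩
  · let := configurationBorel d X
    have hf : Continuous f := f.2.1.continuous
    have hm : Measurable fun γ : Configuration X => Real.exp (γ.pairing f) :=
      Real.measurable_exp.comp (Configuration.measurable_pairing d f)
    have hL := hπ.lintegral_exp_pairing hf f.2.2
    refine ⟨⟨hm.aestronglyMeasurable, ?_⟩, ?_, ?_⟩
    -- The integrand is positive, so the finite value of its lower integral yields both
    -- integrability and the formula.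
    · rw [hasFiniteIntegral_iff_ofReal (Filter.Eventually.of_forall fun γ => (Real.exp_pos _).le),
        hL]
      exact ENNReal.ofReal_lt_top
    · exact ((Real.continuous_exp.comp hf).sub continuous_const).integrable_of_hasCompactSupport
        (f.2.2.comp_left (g := fun t => Real.exp t - 1) (by simp))
    · rw [integral_eq_lintegral_of_nonneg_ae (Filter.Eventually.of_forall fun γ =>
        (Real.exp_pos _).le) hm.aestronglyMeasurable, hL, ENNReal.toReal_ofReal (Real.exp_pos _).le]
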